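/- Let $H$ be a complex Hilbert space, let $c$ be a bounded operator on $H$, let $N$ be the von Neumann algebra generated by $c$ (containing the identity of $H$), and let $\tau$ be a faithful normal tracial state on $N$ (so $N$ is finite). Put $$W(c)=\{\langle cx,x\rangle: x\in H,\ \|x\|=1\},\qquad W_{ab}(c)=\{f(c): f\text{ a state on the C*-algebra generated by } c \text{ and } 1\},$$ and let $B=\{(\tau(a),\tau(ac)): a\in N,\ 0\le a\le 1\}\subset\mathbb R\times\mathbb C$ be the spectral scale of $c$, with isotrace slices $I_t=\{(s,z)\in B: s=t\}$, $0<t<1$. The relative boundary of a convex set is its boundary within its affine span, with the convention that the relative boundary of a one-point set is that set itself. Radial complex slopes of $B$ at the origin. If $c$ is a scalar multiple of $1$, the only radial complex slope is $\tau(c)$ (in the direction $\theta=0$). If $c$ is not a scalar, let $\theta$ be a direction for which, for every $0<t<1$, there is $r_{t,\theta}\ge 0$ such that $(t,\ r_{t,\theta}e^{i\theta}+t\,\tau(c))$ lies on the relative boundary of $I_t$; then the radial complex slope of $B$ at the origin in the direction $\theta$ is $r_\theta e^{i\theta}+\tau(c)$, where $r_\theta=\lim_{t\downarrow 0} r_{t,\theta}/t$.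 Theorem. $W_{ab}(c)=\overline{W(c)}$; for every $\theta$ as above the limit $\lim_{t\downarrow 0} r_{t,\theta}/t$ exists and is finite; and the relative boundary points of $W_{ab}(c)$ are exactly the radial complex slopes of $B$ at the origin. -/

import Mathlib

open Filter Topology
open scoped ComplexOrder

/-- `N` is the von Neumann algebra generated by `c`: the smallest von Neumann algebra on `H`
(unital, as in Mathlib) that contains `c`. -/
def IsVonNeumannGeneratedBy {H : Type*} [NormedAddCommGroup H] [InnerProductSpace ℂ H] [CompleteSpace H]
    (N : VonNeumannAlgebra H) (c : H →L[ℂ] H) : Prop :=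
  IsLeast {M : VonNeumannAlgebra H | c ∈ M} N

/-- A faithful normal tracial state on a von Neumann algebra. The order on operators is the
Loewner order. (A von Neumann algebra that has such a state is automatically finite.) -/
structure FaithfulNormalTracialState {H : Type*} [NormedAddCommGroup H] [InnerProductSpace ℂ H]
    [CompleteSpace H] (N : VonNeumannAlgebra H) where
  /-- The underlying linear functional. -/
  toFun : N.toStarSubalgebra →ₗ[ℂ] ℂ
  map_one : toFun 1 = 1
  nonneg : ∀ a, 0 ≤ toFun (star a * a)
  tracial : ∀ a b, toFun (a * b) = toFun (b * a)
  faithful : ∀ a, toFun (star a * a) = 0 → a = 0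
  /-- Normality: suprema of increasing nets of positive elements are preserved. -/
  normal : ∀ (S : Set N.toStarSubalgebra) (a : N.toStarSubalgebra), S.Nonempty →
    (∀ x ∈ S, 0 ≤ (x : H →L[ℂ] H)) →
    DirectedOn (· ≤ ·) ((fun x : N.toStarSubalgebra => (x : H →L[ℂ] H)) '' S) →
    IsLUB ((fun x : N.toStarSubalgebra => (x : H →L[ℂ] H)) '' S) (a : H →L[ℂ] H) →
    IsLUB ((fun x => (toFun x).re) '' S) (toFun a).re

/-- The numerical range `W(d)`. (Mathlib's inner product is linear in the second variable.) -/
def numRange {H : Type*} [NormedAddCommGroup H] [InnerProductSpace ℂ H]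
    (d : H →L[ℂ] H) : Set ℂ :=
  {z | ∃ x : H, ‖x‖ = 1 ∧ z = inner ℂ x (d x)}

/-- A state on a unital C*-algebra of operators: a positive unital linear functional. -/
structure IsState {H : Type*} [NormedAddCommGroup H] [InnerProductSpace ℂ H] [CompleteSpace H]
    {A : StarSubalgebra ℂ (H →L[ℂ] H)} (f : A →ₗ[ℂ] ℂ) : Prop where
  map_one : f 1 = 1
  nonneg : ∀ a, 0 ≤ f (star a * a)

/-- The abstract numerical range `W_ab(d)`: the values at `d` of the states on the C*-algebra
generated by `d` and `1`. -/
def absNumRange {H : Type*} [NormedAddCommGroup H] [InnerProductSpace ℂ H] [CompleteSpace H]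
    (d : H →L[ℂ] H) : Set ℂ :=
  {z | ∃ f : StarAlgebra.elemental ℂ d →ₗ[ℂ] ℂ, IsState f ∧
    z = f ⟨d, StarAlgebra.elemental.self_mem ℂ d⟩}

/-- The relative boundary of a convex set (its boundary within its affine span), with the
convention that the relative boundary of a one-point set is that set. -/
def relBoundary {E : Type*} [NormedAddCommGroup E] [NormedSpace ℝ E] (S : Set E) : Set E :=
  {x | x ∈ intrinsicFrontier ℝ S ∨ S = {x}}

section SpectralScale

variable {H : Type*} [NormedAddCommGroup H] [InnerProductSpace ℂ H] [CompleteSpace H]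
  {N : VonNeumannAlgebra H}

/-- The spectral scale `B(c) = {(τ(a), τ(ac)) : a ∈ N, 0 ≤ a ≤ 1}` in `ℝ × ℂ`
(`τ(a)` is real for such `a`). -/
def spectralScale (τ : FaithfulNormalTracialState N) (c : N.toStarSubalgebra) : Set (ℝ × ℂ) :=
  {p | ∃ a : N.toStarSubalgebra, 0 ≤ (a : H →L[ℂ] H) ∧ (a : H →L[ℂ] H) ≤ 1 ∧
    p = ((τ.toFun a).re, τ.toFun (a * c))}

/-- The isotrace slice `I_t` of `B(c)`. -/
def isotraceSlice (τ : FaithfulNormalTracialState N) (c : N.toStarSubalgebra) (t : ℝ) :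
    Set (ℝ × ℂ) :=
  {p ∈ spectralScale τ c | p.1 = t}

/-- `r = r_{t,θ}`: the point of `I_t` at distance `r ≥ 0` in the direction `θ` from the point
`(t, tτ(c))` of the central axis is on the relative boundary of `I_t`. -/
def IsSliceRadius (τ : FaithfulNormalTracialState N) (c : N.toStarSubalgebra) (t θ r : ℝ) : Prop :=
  0 ≤ r ∧ ((t, r * Complex.exp (θ * Complex.I) + t * τ.toFun c) : ℝ × ℂ) ∈
    relBoundary (isotraceSlice τ c t)

/-- `r t` is a radius `r_{t,θ}` of the slice `I_t` in the direction `θ`, for all `0 < t < 1`. -/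
def IsRadialFunction (τ : FaithfulNormalTracialState N) (c : N.toStarSubalgebra) (θ : ℝ)
    (r : ℝ → ℝ) : Prop :=
  ∀ t ∈ Set.Ioo (0 : ℝ) 1, IsSliceRadius τ c t θ (r t)

/-- `μ` is the radial complex slope of `B(c)` at the origin in the direction `θ`. If `c` is a
scalar, the only slope is that of the chord `B(c)`, in the direction `0`. Otherwise the slope is
`r_θ e^{iθ} + τ(c)` with `r_θ = lim_{t ↓ 0} r_{t,θ} / t`, for the directions `θ` in which the
slices have relative boundary points (all `θ` if `B(c)` has interior, two opposite ones if
`B(c)` is planar). -/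
def IsRadialComplexSlope (τ : FaithfulNormalTracialState N) (c : N.toStarSubalgebra) (θ : ℝ)
    (μ : ℂ) : Prop :=
  (c = algebraMap ℂ N.toStarSubalgebra (τ.toFun c) ∧ θ = 0 ∧ μ = τ.toFun c) ∨
  (c ≠ algebraMap ℂ N.toStarSubalgebra (τ.toFun c) ∧
    ∃ (r : ℝ → ℝ) (ρ : ℝ), IsRadialFunction τ c θ r ∧
      Tendsto (fun t => r t / t) (𝓝[>] 0) (𝓝 ρ) ∧
      μ = ρ * Complex.exp (θ * Complex.I) + τ.toFun c)

end SpectralScale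

/-! Every state value is approximated by values of density states, and the slices of the spectral
scale consist of such values.

For `0 < t < 1` put `S_t = t⁻¹ I_t - τ(c)`, the second coordinates of the slice, scaled and centred:
the numbers `τ(ac) / t - τ(c)` with `0 ≤ a ≤ 1` and `τ(a) = t`. By the trace property each
`x ↦ τ(ax) / t` is a state, so `S_t ⊆ W_ab(c) - τ(c)`; and `S_t` grows as `t` decreases. The union
of the `S_t` is dense in `W_ab(c) - τ(c)` (`numRange_subset_closure_densityRange`): a half-plane that
contains all values `τ(ac)` of densities `a` corresponds to a self-adjoint `k` with `τ(ak) ≥ 0` for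
all `a ≥ 0`, and testing against the negative part of `k` with the faithful trace shows `k ≥ 0`, so
the half-plane contains the numerical range. Together with `W_ab(c) = closure W(c)`, which rests on
the Toeplitz–Hausdorff theorem and on limits of vector states along an ultrafilter, this covers
`W_ab(c)`.

All the `S_t` are neighbourhoods of the origin in one real subspace of `ℂ`, the `slopeSpace`, which
is nonzero unless `c` is a scalar. There the boundary of a convex neighbourhood of the origin is the
level set `gauge = 1`, the radius `r_{t,θ} / t` is the inverse of the gauge of `S_t` at `e^{iθ}`, and a convex
set has the same interior as its closure, so the gauges of the `S_t` converge to the gauge of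
`W_ab(c) - τ(c)` as `t ↓ 0` (`tendsto_gauge_of_antitoneOn`). Hence the limits `r_θ` exist, are
finite, and parametrize the boundary of `W_ab(c)` in polar coordinates around `τ(c)`. -/

open scoped ComplexStarModule Pointwise

/-! ### Relative boundaries and gauges of convex sets -/

theorem intrinsicFrontier_eq_frontier_of_mem_nhds {E : Type*} [NormedAddCommGroup E]
    [NormedSpace ℝ E] {S : Set E} {x : E} (hS : S ∈ 𝓝 x) :
    intrinsicFrontier ℝ S = frontier S := by
  have htop : affineSpan ℝ S = ⊤ :=
    affineSpan_eq_top_of_nonempty_interior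
      (Set.Nonempty.mono (interior_mono (subset_convexHull ℝ S))
        ⟨x, mem_interior_iff_mem_nhds.2 hS⟩)
  have hopen : IsOpen ((affineSpan ℝ S : AffineSubspace ℝ E) : Set E) := by
    rw [htop]; exact isOpen_univ
  have h := hopen.isOpenMap_subtype_val.preimage_frontier_eq_frontier_preimage
    continuous_subtype_val S
  calc intrinsicFrontier ℝ S = Subtype.val '' (Subtype.val ⁻¹' frontier S :
        Set (affineSpan ℝ S)) := congrArg _ h.symm
    _ = frontier S := Set.image_preimage_eq_of_subset
        fun y _ => ⟨⟨y, by rw [htop]; trivial⟩, rfl⟩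

theorem relBoundary_singleton {E : Type*} [NormedAddCommGroup E] [NormedSpace ℝ E] (x : E) :
    relBoundary {x} = {x} := by
  ext y
  simp [relBoundary, eq_comm]

/-- The relative boundary of an isometrically embedded neighbourhood of the origin is the image of
its topological boundary. Nontriviality excludes the one-point convention. -/
theorem relBoundary_image_of_mem_nhds {E F : Type*} [NormedAddCommGroup E] [NormedSpace ℝ E]
    [Nontrivial E] [NormedAddCommGroup F] [NormedSpace ℝ F] (φ : E →ᵃⁱ[ℝ] F) {S : Set E}
    (hS : S ∈ 𝓝 0) : relBoundary (φ '' S) = φ '' frontier S := by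
  rw [← intrinsicFrontier_eq_frontier_of_mem_nhds hS, ← AffineIsometry.intrinsicFrontier_image]
  ext x
  refine ⟨fun h => h.resolve_right fun hx => ?_, Or.inl⟩
  have hsub : S.Subsingleton := by
    intro a ha b hb
    apply φ.injective
    have h1 : φ a ∈ ({x} : Set F) := hx ▸ Set.mem_image_of_mem _ ha
    have h2 : φ b ∈ ({x} : Set F) := hx ▸ Set.mem_image_of_mem _ hb
    rw [Set.mem_singleton_iff.1 h1, Set.mem_singleton_iff.1 h2]
  have h0 : S ⊆ {0} := fun a ha => hsub ha (mem_of_mem_nhds hS)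
  have := Module.punctured_nhds_neBot ℝ E 0
  exact infinite_of_mem_nhds 0 (Filter.mem_of_superset hS h0) (Set.finite_singleton 0)

/-- The gauges of convex neighbourhoods `S t` of `0` that grow as `t` decreases to `0` converge
pointwise to the gauge of any convex set lying between their union and its closure. -/
theorem tendsto_gauge_of_antitoneOn {E : Type*} [NormedAddCommGroup E] [NormedSpace ℝ E]
    {S : ℝ → Set E} {K : Set E}
    (hconv : ∀ t ∈ Set.Ioo (0 : ℝ) 1, Convex ℝ (S t))
    (hnhds : ∀ t ∈ Set.Ioo (0 : ℝ) 1, S t ∈ 𝓝 0)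
    (hanti : AntitoneOn S (Set.Ioo (0 : ℝ) 1))
    (hSK : ∀ t ∈ Set.Ioo (0 : ℝ) 1, S t ⊆ K)
    (hK : Convex ℝ K) (hKS : K ⊆ closure (⋃ t : Set.Ioo (0 : ℝ) 1, S t)) (u : E) :
    Tendsto (fun t => gauge (S t) u) (𝓝[>] 0) (𝓝 (gauge K u)) := by
  have hmem : Set.Ioo (0 : ℝ) 1 ∈ 𝓝[>] (0 : ℝ) := Ioo_mem_nhdsGT one_pos
  have hhalf : (1 / 2 : ℝ) ∈ Set.Ioo (0 : ℝ) 1 := by norm_num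
  have hK0 : K ∈ 𝓝 (0 : E) := Filter.mem_of_superset (hnhds _ hhalf) (hSK _ hhalf)
  set U : Set E := ⋃ t : Set.Ioo (0 : ℝ) 1, S t with hU
  have hU0 : U ∈ 𝓝 (0 : E) :=
    Filter.mem_of_superset (hnhds _ hhalf) (Set.subset_iUnion_of_subset ⟨_, hhalf⟩ subset_rfl)
  have hUconv : Convex ℝ U := by
    refine Directed.convex_iUnion ?_ fun t => hconv t t.2
    intro s t
    rcases le_total (s : ℝ) t with h | h
    · exact ⟨s, subset_rfl, hanti s.2 t.2 h⟩
    · exact ⟨t, hanti t.2 s.2 h, subset_rfl⟩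
  refine tendsto_order.2 ⟨fun a ha => ?_, fun a ha => ?_⟩
  · filter_upwards [hmem] with t ht
    exact ha.trans_le (gauge_mono (absorbent_nhds_zero (hnhds t ht)) (hSK t ht) u)
  · obtain ⟨b, hb, hba⟩ := exists_between ha
    have hb0 : 0 < b := (gauge_nonneg u).trans_lt hb
    have h1 : b⁻¹ • u ∈ interior K := by
      rw [← gauge_lt_one_iff_mem_interior hK hK0, gauge_smul_of_nonneg (inv_nonneg.2 hb0.le),
        smul_eq_mul, inv_mul_lt_iff₀ hb0, mul_one]
      exact hb
    -- A convex set with interior points has the same interior as its closure.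
    have h2 : b⁻¹ • u ∈ U := by
      have := interior_mono hKS h1
      rw [hUconv.interior_closure_eq_interior_of_nonempty_interior
        ⟨0, mem_interior_iff_mem_nhds.2 hU0⟩] at this
      exact interior_subset this
    obtain ⟨s, hs⟩ := Set.mem_iUnion.1 h2
    filter_upwards [Ioo_mem_nhdsGT s.2.1] with t ht
    have ht1 : t ∈ Set.Ioo (0 : ℝ) 1 := ⟨ht.1, ht.2.trans s.2.2⟩
    refine (gauge_le_of_mem hb0.le ?_).trans_lt hba
    exact (Set.mem_smul_set_iff_inv_smul_mem₀ hb0.ne' _ _).2 (hanti ht1 s.2 ht.2.le hs)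

/-! ### The Toeplitz–Hausdorff theorem -/

section NumericalRange
variable {H : Type*} [NormedAddCommGroup H] [InnerProductSpace ℂ H]

theorem inner_div_norm_sq_mem_numRange (d : H →L[ℂ] H) {z : H} (hz : z ≠ 0) :
    inner ℂ z (d z) / (‖z‖ : ℂ) ^ 2 ∈ numRange d := by
  refine ⟨(‖z‖ : ℂ)⁻¹ • z, norm_smul_inv_norm hz, ?_⟩
  simp only [map_smul, inner_smul_left, inner_smul_right, map_inv₀, Complex.conj_ofReal]
  have : (‖z‖ : ℂ) ≠ 0 := by simpa using hz
  field_simp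

/-- The normalized case of the Toeplitz–Hausdorff theorem: if `0` and `1` are values of the
quadratic form of `A` at unit vectors, so is every number between them. -/
theorem exists_inner_eq_of_mem_Icc (A : H →L[ℂ] H) {x y : H} (hx : ‖x‖ = 1) (hy : ‖y‖ = 1)
    (hx0 : inner ℂ x (A x) = 0) (hy1 : inner ℂ y (A y) = 1) {t : ℝ} (ht : t ∈ Set.Icc (0 : ℝ) 1) :
    ∃ z : H, z ≠ 0 ∧ inner ℂ z (A z) / (‖z‖ : ℂ) ^ 2 = t := by
  -- A unimodular multiple of `y` makes the form real on the real span of `x` and `y`.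
  obtain ⟨l, hl, hlim⟩ : ∃ l : ℂ, l * star l = 1 ∧
      (l * inner ℂ x (A y) + star l * inner ℂ y (A x)).im = 0 := by
    set w : ℂ := inner ℂ x (A y) - star (inner ℂ y (A x)) with hw
    have key : ∀ l : ℂ, (l * inner ℂ x (A y) + star l * inner ℂ y (A x)).im = (l * w).im := by
      intro l
      simp only [hw, Complex.add_im, Complex.mul_im, Complex.star_def, Complex.conj_re,
        Complex.conj_im, Complex.sub_re, Complex.sub_im]
      ring
    by_cases h : w = 0
    · exact ⟨1, by simp, by rw [key, h]; simp⟩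
    · have hn : (‖w‖ : ℂ) ≠ 0 := by simpa using h
      have hws : star w * w = (‖w‖ : ℂ) ^ 2 := by
        rw [Complex.star_def, Complex.conj_mul']
      refine ⟨star w / ‖w‖, ?_, ?_⟩
      · rw [star_div₀, star_star, show star (‖w‖ : ℂ) = ‖w‖ from Complex.conj_ofReal _]
        field_simp
        exact hws
      · rw [key, div_mul_eq_mul_div, hws, sq, mul_div_assoc, div_self hn, mul_one,
          Complex.ofReal_im]
  set y' : H := l • y with hy'
  set p : ℝ := (l * inner ℂ x (A y) + star l * inner ℂ y (A x)).re with hp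
  have hpc : inner ℂ x (A y') + inner ℂ y' (A x) = (p : ℂ) := by
    rw [hy', map_smul, inner_smul_right, inner_smul_left]
    exact Complex.ext (by simp [hp]) (by simpa using hlim)
  have hy1' : inner ℂ y' (A y') = 1 := by
    rw [hy', map_smul, inner_smul_right, inner_smul_left, hy1, mul_one]; exact hl
  have hform : ∀ s : ℝ, inner ℂ (((1 - s : ℝ) : ℂ) • x + (s : ℂ) • y')
      (A (((1 - s : ℝ) : ℂ) • x + (s : ℂ) • y')) = ((s * (1 - s) * p + s ^ 2 : ℝ) : ℂ) := by
    intro s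
    simp only [map_add, map_smul, inner_add_left, inner_add_right, inner_smul_left,
      inner_smul_right, Complex.conj_ofReal, hx0, hy1']
    push_cast
    linear_combination ((s : ℂ) * (1 - s)) * hpc
  have hne : ∀ s : ℝ, ((1 - s : ℝ) : ℂ) • x + (s : ℂ) • y' ≠ 0 := by
    intro s hs
    have hx' : x ≠ 0 := by intro h; simp [h] at hx
    -- A vanishing combination has `s ≠ 0`, so `y'` is a multiple of `x`, against the two values.
    have h0 := hform s
    rw [hs] at h0
    have hs0 : s ≠ 0 := by
      rintro rfl
      simp [hx'] at hs
    have h2 : (s : ℂ) • y' = -(((1 - s : ℝ) : ℂ) • x) := by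
      rw [eq_neg_iff_add_eq_zero, add_comm]; exact hs
    have h3 : inner ℂ ((s : ℂ) • y') (A ((s : ℂ) • y')) = 0 := by
      rw [h2]
      simp [map_neg, map_smul, inner_neg_left, inner_neg_right, inner_smul_left,
        inner_smul_right, hx0]
    rw [map_smul, inner_smul_left, inner_smul_right, hy1', Complex.conj_ofReal] at h3
    simp [hs0] at h3
  set z : ℝ → H := fun s => ((1 - s : ℝ) : ℂ) • x + (s : ℂ) • y' with hz
  have hzc : Continuous z := by fun_prop
  have hfc : Continuous (fun s : ℝ => (s * (1 - s) * p + s ^ 2) / ‖z s‖ ^ 2) := by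
    refine Continuous.div (by fun_prop) (by fun_prop) fun s => ?_
    exact pow_ne_zero _ (norm_ne_zero_iff.2 (hne s))
  have hnl : ‖l‖ = 1 := by
    have : ‖l‖ * ‖l‖ = 1 := by
      rw [← norm_one (α := ℂ), ← hl, norm_mul, norm_star]
    nlinarith [norm_nonneg l]
  have h01 := intermediate_value_Icc (zero_le_one (α := ℝ)) hfc.continuousOn
  have hz1 : z 1 = y' := by simp [hz]
  have hny : ‖y'‖ = 1 := by rw [hy', norm_smul, hnl, hy, one_mul]
  simp only [hz1, hny] at h01
  norm_num at h01
  obtain ⟨s, -, hs⟩ := h01 ht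
  refine ⟨z s, hne s, ?_⟩
  rw [hform s, ← hs]
  push_cast
  rfl

/-- The **Toeplitz–Hausdorff theorem**. -/
theorem convex_numRange (d : H →L[ℂ] H) : Convex ℝ (numRange d) := by
  rw [convex_iff_segment_subset]
  rintro p ⟨x, hx, hpx⟩ q ⟨y, hy, hqy⟩
  rw [segment_eq_image']
  rintro - ⟨t, ht, rfl⟩
  by_cases hpq : q = p
  · rw [hpq]; simpa using ⟨x, hx, hpx⟩
  have hqp : q - p ≠ 0 := sub_ne_zero.2 hpq
  set A : H →L[ℂ] H := (q - p)⁻¹ • (d - p • 1) with hA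
  have hAv : ∀ v : H, inner ℂ v (A v) = (q - p)⁻¹ * (inner ℂ v (d v) - p * (‖v‖ : ℂ) ^ 2) := by
    intro v
    simp [hA]
  obtain ⟨z, hz, hzt⟩ := exists_inner_eq_of_mem_Icc A hx hy
    (by rw [hAv, ← hpx, hx]; simp) (by rw [hAv, ← hqy, hy]; simp [hqp]) ht
  have hz' : (‖z‖ : ℂ) ≠ 0 := by simpa using hz
  convert inner_div_norm_sq_mem_numRange d hz using 1
  rw [hAv] at hzt
  simp only [Complex.real_smul, ← hzt]
  field_simp
  ring

end NumericalRange

/-! ### Positive functionals and the abstract numerical range -/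

section PositiveFunctionals
theorem im_map_eq_zero_of_isSelfAdjoint {A : Type*} [Ring A] [StarRing A] [Algebra ℂ A]
    {f : A →ₗ[ℂ] ℂ} (hf : ∀ a, 0 ≤ f (star a * a)) {h : A}
    (hh : IsSelfAdjoint h) : (f h).im = 0 := by
  have h1 := (Complex.nonneg_iff.1 (hf (h + 1))).2
  have h2 := (Complex.nonneg_iff.1 (hf (h - 1))).2
  have h3 : star (h + 1) * (h + 1) - star (h - 1) * (h - 1) = (4 : ℂ) • h := by
    rw [star_add, star_sub, hh.star_eq, star_one]
    have : (4 : ℂ) • h = h + h + h + h := by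
      rw [show (4 : ℂ) = 1 + 1 + 1 + 1 by norm_num]; simp only [add_smul, one_smul]
    rw [this]; noncomm_ring
  have h4 := congrArg Complex.im (congrArg f h3)
  rw [map_sub, map_smul, Complex.sub_im, ← h1, ← h2, smul_eq_mul, Complex.mul_im] at h4
  norm_num at h4
  exact h4

theorem map_realPart_eq_re {A : Type*} [Ring A] [StarRing A] [Algebra ℂ A] [StarModule ℂ A]
    {f : A →ₗ[ℂ] ℂ} (hf : ∀ a, 0 ≤ f (star a * a)) (a : A) :
    f (ℜ a : A) = ((f a).re : ℂ) := by
  have h := congrArg f (realPart_add_I_smul_imaginaryPart a)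
  have h1 := im_map_eq_zero_of_isSelfAdjoint hf (ℜ a).2
  have h2 := im_map_eq_zero_of_isSelfAdjoint hf (ℑ a).2
  rw [map_add, map_smul] at h
  apply Complex.ext
  · rw [← h]; simp [h2]
  · simpa using h1

end PositiveFunctionals

/-- Every real-linear functional on `ℂ` is the real part of multiplication by a complex number. -/
theorem exists_re_mul_eq (l : StrongDual ℝ ℂ) : ∃ w : ℂ, ∀ z, l z = (w * z).re := by
  refine ⟨⟨l 1, -l Complex.I⟩, fun z => ?_⟩
  have h : z = z.re • (1 : ℂ) + z.im • Complex.I := by simp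
  rw [h, map_add, map_smul, map_smul]
  simp
  ring

section Operators
variable {H : Type*} [NormedAddCommGroup H] [InnerProductSpace ℂ H] [CompleteSpace H]

theorem smul_one_sub_realPart_nonneg_iff (d : H →L[ℂ] H) (w : ℂ) (u : ℝ) :
    0 ≤ (u : ℂ) • (1 : H →L[ℂ] H) - (ℜ (w • d) : H →L[ℂ] H) ↔
      ∀ x : H, ‖x‖ = 1 → (w * inner ℂ x (d x)).re ≤ u := by
  have key : ∀ x : H, inner ℂ (((u : ℂ) • (1 : H →L[ℂ] H) - (ℜ (w • d) : H →L[ℂ] H)) x) x =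
      ((u * ‖x‖ ^ 2 - (w * inner ℂ x (d x)).re : ℝ) : ℂ) := by
    intro x
    have h1 : inner ℂ x x = (‖x‖ : ℂ) ^ 2 := inner_self_eq_norm_sq_to_K x
    have h2 : inner ℂ ((star d) x) x = inner ℂ x (d x) :=
      ContinuousLinearMap.adjoint_inner_left d x x
    have h3 : inner ℂ (d x) x = star (inner ℂ x (d x)) := (inner_conj_symm (d x) x).symm
    rw [realPart_apply_coe]
    simp only [sub_apply, smul_apply,
      one_apply_eq_self, star_smul, add_apply, inner_sub_left,
      inner_smul_left, inner_add_left, h1, h2, h3, inner_smul_left_eq_smul,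
      Complex.conj_ofReal, Complex.real_smul, Complex.star_def, Complex.conj_conj]
    generalize inner ℂ x (d x) = p
    apply Complex.ext
    · simp [← Complex.ofReal_pow]
      ring
    · simp [← Complex.ofReal_pow]
      ring
  rw [ContinuousLinearMap.nonneg_iff_isPositive, ContinuousLinearMap.isPositive_iff_complex]
  constructor
  · intro h x hx
    have := (h x).2
    rw [key, hx] at this
    simpa using this
  · intro h x
    rw [key]
    refine ⟨by simp only [RCLike.re_to_complex, Complex.ofReal_re], ?_⟩
    rcases eq_or_ne x 0 with rfl | hx
    · simp
    have hn : ‖x‖ ≠ 0 := norm_ne_zero_iff.2 hx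
    have h1 := h ((‖x‖ : ℂ)⁻¹ • x) (norm_smul_inv_norm hx)
    simp only [map_smul, inner_smul_left, inner_smul_right, map_inv₀, Complex.conj_ofReal] at h1
    rw [show w * ((‖x‖ : ℂ)⁻¹ * ((‖x‖ : ℂ)⁻¹ * inner ℂ x (d x))) =
      ((‖x‖ ^ 2)⁻¹ : ℝ) * (w * inner ℂ x (d x)) by push_cast; field_simp,
      Complex.re_ofReal_mul, inv_mul_le_iff₀ (by positivity)] at h1
    simp only [RCLike.re_to_complex, Complex.ofReal_re]
    linarith

theorem StarSubalgebra.exists_star_mul_self_eq {S : StarSubalgebra ℂ (H →L[ℂ] H)}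
    (hS : IsClosed (S : Set (H →L[ℂ] H))) {a : S} (ha : 0 ≤ (a : H →L[ℂ] H)) :
    ∃ b : S, star b * b = a := by
  have : IsClosed (S : Set (H →L[ℂ] H)) := hS
  have hb : cfc Real.sqrt (a : H →L[ℂ] H) ∈ S := cfc_mem _ a.2
  refine ⟨⟨_, hb⟩, Subtype.ext ?_⟩
  have hsa : star (cfc Real.sqrt (a : H →L[ℂ] H)) = cfc Real.sqrt (a : H →L[ℂ] H) :=
    (cfc_predicate (R := ℝ) (p := IsSelfAdjoint) Real.sqrt (a : H →L[ℂ] H)).star_eq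
  change star (cfc Real.sqrt (a : H →L[ℂ] H)) * cfc Real.sqrt (a : H →L[ℂ] H) = a
  rw [hsa, ← cfc_mul Real.sqrt Real.sqrt (a : H →L[ℂ] H)]
  conv_rhs => rw [← cfc_id ℝ (a : H →L[ℂ] H)]
  refine cfc_congr fun x hx => ?_
  exact Real.mul_self_sqrt (spectrum_nonneg_of_nonneg ha hx)

theorem StarSubalgebra.coe_realPart {S : StarSubalgebra ℂ (H →L[ℂ] H)} (a : S) :
    (((ℜ a : selfAdjoint S) : S) : H →L[ℂ] H) = (ℜ (a : H →L[ℂ] H) : H →L[ℂ] H) := by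
  rw [realPart_apply_coe, realPart_apply_coe]
  rfl

theorem absNumRange_subset_closure_numRange (d : H →L[ℂ] H) :
    absNumRange d ⊆ closure (numRange d) := by
  rintro z ⟨f, hf, rfl⟩
  by_contra hz
  obtain ⟨l, u, hlu, hul⟩ := geometric_hahn_banach_closed_point (convex_numRange d).closure
    isClosed_closure hz
  obtain ⟨w, hw⟩ := exists_re_mul_eq l
  set d' : StarAlgebra.elemental ℂ d := ⟨d, StarAlgebra.elemental.self_mem ℂ d⟩
  have hpos : 0 ≤ (u : ℂ) • (1 : H →L[ℂ] H) - (ℜ (w • d) : H →L[ℂ] H) := by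
    rw [smul_one_sub_realPart_nonneg_iff]
    intro x hx
    rw [← hw]
    exact (hlu _ (subset_closure ⟨x, hx, rfl⟩)).le
  have hcoe : (((u : ℂ) • 1 - (ℜ (w • d') : StarAlgebra.elemental ℂ d) :
      StarAlgebra.elemental ℂ d) : H →L[ℂ] H) = (u : ℂ) • 1 - (ℜ (w • d) : H →L[ℂ] H) := by
    change (u : ℂ) • (1 : H →L[ℂ] H) - ((ℜ (w • d') : StarAlgebra.elemental ℂ d) : H →L[ℂ] H) = _
    rw [StarSubalgebra.coe_realPart]
    rfl
  obtain ⟨b, hb⟩ := StarSubalgebra.exists_star_mul_self_eq (StarAlgebra.elemental.isClosed ℂ d)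
    (hcoe ▸ hpos)
  have h := hf.nonneg b
  rw [hb, map_sub, map_smul, hf.map_one] at h
  have hre := map_realPart_eq_re hf.nonneg (w • d')
  rw [f.map_smul] at hre
  rw [hre] at h
  have h' := (Complex.nonneg_iff.1 h).1
  rw [hw] at hul
  simp at h' hul
  linarith

/-- A limit of values of vector states is the value of an ultrafilter limit of these states. -/
theorem closure_numRange_subset_absNumRange (d : H →L[ℂ] H) :
    closure (numRange d) ⊆ absNumRange d := by
  intro z hz
  obtain ⟨s, hs, hsz⟩ := mem_closure_iff_seq_limit.1 hz
  choose x hx hsx using hs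
  set φ : Ultrafilter ℕ := hyperfilter ℕ
  have hlim : ∀ a : H →L[ℂ] H, ∃ y : ℂ,
      Tendsto (fun n => inner ℂ (x n) (a (x n))) φ (𝓝 y) := by
    intro a
    have hle : ∀ n, inner ℂ (x n) (a (x n)) ∈ Metric.closedBall (0 : ℂ) ‖a‖ := by
      intro n
      rw [mem_closedBall_zero_iff]
      calc ‖inner ℂ (x n) (a (x n))‖ ≤ ‖x n‖ * ‖a (x n)‖ := norm_inner_le_norm _ _
        _ ≤ ‖x n‖ * (‖a‖ * ‖x n‖) := by gcongr; exact a.le_opNorm _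
        _ = ‖a‖ := by rw [hx]; ring
    obtain ⟨y, -, hy⟩ := (isCompact_closedBall (0 : ℂ) ‖a‖).ultrafilter_le_nhds
      (φ.map fun n => inner ℂ (x n) (a (x n))) (by
        rw [le_principal_iff]
        exact Filter.mem_map.2 (Filter.univ_mem' hle))
    exact ⟨y, hy⟩
  choose g hg using hlim
  let f : StarAlgebra.elemental ℂ d →ₗ[ℂ] ℂ :=
    { toFun := fun a => g a
      map_add' := fun a b => by
        refine tendsto_nhds_unique (hg _) (((hg a).add (hg b)).congr fun n => ?_)
        simp
      map_smul' := fun r a => by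
        refine tendsto_nhds_unique (hg _) (((hg a).const_mul r).congr fun n => ?_)
        simp }
  refine ⟨f, ⟨?_, fun a => ?_⟩, ?_⟩
  · refine tendsto_nhds_unique (hg _) (tendsto_const_nhds.congr fun n => ?_)
    simp [hx]
  · refine ge_of_tendsto' (hg _) fun n => ?_
    have : inner ℂ (x n) ((star (a : H →L[ℂ] H) * (a : H →L[ℂ] H)) (x n)) =
        inner ℂ ((a : H →L[ℂ] H) (x n)) ((a : H →L[ℂ] H) (x n)) :=
      ContinuousLinearMap.adjoint_inner_right (a : H →L[ℂ] H) _ _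
    change 0 ≤ inner ℂ (x n) ((star (a : H →L[ℂ] H) * (a : H →L[ℂ] H)) (x n))
    rw [this]
    rw [inner_self_eq_norm_sq_to_K]
    positivity
  · refine tendsto_nhds_unique ((hsz.mono_left (Nat.hyperfilter_le_atTop)).congr fun n => ?_) (hg _)
    exact hsx n

theorem absNumRange_eq_closure_numRange (d : H →L[ℂ] H) :
    absNumRange d = closure (numRange d) :=
  (absNumRange_subset_closure_numRange d).antisymm (closure_numRange_subset_absNumRange d)

end Operators

theorem isBounded_numRange {H : Type*} [NormedAddCommGroup H] [InnerProductSpace ℂ H]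
    (d : H →L[ℂ] H) : Bornology.IsBounded (numRange d) := by
  refine (Metric.isBounded_closedBall (x := (0 : ℂ)) (r := ‖d‖)).subset ?_
  rintro - ⟨x, hx, rfl⟩
  rw [mem_closedBall_zero_iff]
  calc ‖inner ℂ x (d x)‖ ≤ ‖x‖ * ‖d x‖ := norm_inner_le_norm _ _
    _ ≤ ‖x‖ * (‖d‖ * ‖x‖) := by gcongr; exact d.le_opNorm _
    _ = ‖d‖ := by rw [hx]; ring

/-! ### Density states of a tracial von Neumann algebra -/

section Trace
variable {H : Type*} [NormedAddCommGroup H] [InnerProductSpace ℂ H] [CompleteSpace H]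
  {N : VonNeumannAlgebra H}

theorem VonNeumannAlgebra.isClosed (N : VonNeumannAlgebra H) :
    IsClosed (N.toStarSubalgebra : Set (H →L[ℂ] H)) := by
  rw [VonNeumannAlgebra.coe_toStarSubalgebra, ← N.centralizer_centralizer]
  exact Set.isClosed_centralizer _

namespace FaithfulNormalTracialState
variable (τ : FaithfulNormalTracialState N)

/-- The functional `x ↦ τ(ax)`. -/
noncomputable def leftMul (a : N.toStarSubalgebra) : N.toStarSubalgebra →ₗ[ℂ] ℂ :=
  τ.toFun ∘ₗ LinearMap.mulLeft ℂ a

theorem leftMul_apply (a x : N.toStarSubalgebra) : τ.leftMul a x = τ.toFun (a * x) := rfl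

/-- This is where the trace property makes the spectral scale consist of values of positive
functionals: `τ(b*b x*x) = τ((x b*)* (x b*))`. -/
theorem leftMul_star_mul_self_nonneg {a : N.toStarSubalgebra} (ha : 0 ≤ (a : H →L[ℂ] H))
    (x : N.toStarSubalgebra) : 0 ≤ τ.leftMul a (star x * x) := by
  obtain ⟨b, rfl⟩ := StarSubalgebra.exists_star_mul_self_eq N.isClosed ha
  have h : τ.leftMul (star b * b) (star x * x) = τ.toFun (star (x * star b) * (x * star b)) := by
    rw [leftMul_apply, mul_assoc, τ.tracial, star_mul, star_star]
    simp only [mul_assoc]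
  rw [h]
  exact τ.nonneg _

theorem map_nonneg {a : N.toStarSubalgebra} (ha : 0 ≤ (a : H →L[ℂ] H)) : 0 ≤ τ.toFun a := by
  obtain ⟨b, rfl⟩ := StarSubalgebra.exists_star_mul_self_eq N.isClosed ha
  exact τ.nonneg _

theorem map_eq_ofReal_re {a : N.toStarSubalgebra} (ha : IsSelfAdjoint a) :
    τ.toFun a = ((τ.toFun a).re : ℂ) :=
  Complex.ext rfl (im_map_eq_zero_of_isSelfAdjoint τ.nonneg ha)

theorem eq_zero_of_nonneg_of_map_eq_zero {a : N.toStarSubalgebra} (ha : 0 ≤ (a : H →L[ℂ] H))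
    (h : τ.toFun a = 0) : a = 0 := by
  obtain ⟨b, rfl⟩ := StarSubalgebra.exists_star_mul_self_eq N.isClosed ha
  rw [τ.faithful b h, mul_zero]

/-- The positive cone of `N` is self-dual for the trace: test against the negative part of `k`. -/
theorem nonneg_of_forall_nonneg_map_mul {k : N.toStarSubalgebra} (hk : IsSelfAdjoint k)
    (h : ∀ a : N.toStarSubalgebra, 0 ≤ (a : H →L[ℂ] H) → 0 ≤ (τ.toFun (a * k)).re) :
    0 ≤ (k : H →L[ℂ] H) := by
  have hk' : IsSelfAdjoint (k : H →L[ℂ] H) := congrArg Subtype.val hk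
  have := N.isClosed
  have hmem : (k : H →L[ℂ] H)⁻ ∈ N.toStarSubalgebra := by
    rw [CFC.negPart_def, cfcₙ_eq_cfc]
    exact cfc_mem _ k.2
  have hnonneg := CFC.negPart_nonneg (k : H →L[ℂ] H)
  set b : N.toStarSubalgebra := ⟨_, hmem⟩ with hb
  have hbsa : star b = b := Subtype.ext (IsSelfAdjoint.of_nonneg hnonneg).star_eq
  have hmul : b * k = -(star b * b) := by
    rw [hbsa]
    apply Subtype.ext
    change (k : H →L[ℂ] H)⁻ * (k : H →L[ℂ] H) = -((k : H →L[ℂ] H)⁻ * (k : H →L[ℂ] H)⁻)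
    nth_rw 2 [← CFC.posPart_sub_negPart (k : H →L[ℂ] H) hk']
    rw [mul_sub, CFC.negPart_mul_posPart, zero_sub]
  have h1 := h b hnonneg
  rw [hmul, map_neg, Complex.neg_re] at h1
  have h2 := Complex.nonneg_iff.1 (τ.nonneg b)
  have h3 : b = 0 := τ.faithful b (Complex.ext (le_antisymm (by simpa using h1) h2.1) h2.2.symm)
  rw [← CFC.negPart_eq_zero_iff _ hk']
  exact congrArg Subtype.val h3

end FaithfulNormalTracialState

/-- The values at `c` of the states `x ↦ τ(ax)` of `N` given by densities `a` in `N`. -/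
def densityRange (τ : FaithfulNormalTracialState N) (c : N.toStarSubalgebra) : Set ℂ :=
  {z | ∃ a : N.toStarSubalgebra, 0 ≤ (a : H →L[ℂ] H) ∧ τ.toFun a = 1 ∧ z = τ.toFun (a * c)}

variable (τ : FaithfulNormalTracialState N) (c : N.toStarSubalgebra)

theorem convex_densityRange : Convex ℝ (densityRange τ c) := by
  rintro - ⟨a, ha, ha1, rfl⟩ - ⟨b, hb, hb1, rfl⟩ s t hs ht hst
  refine ⟨(s : ℂ) • a + (t : ℂ) • b, ?_, ?_, ?_⟩
  · change 0 ≤ (s : ℂ) • (a : H →L[ℂ] H) + (t : ℂ) • (b : H →L[ℂ] H)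
    have hs' : (0 : ℂ) ≤ s := by exact_mod_cast hs
    have ht' : (0 : ℂ) ≤ t := by exact_mod_cast ht
    exact add_nonneg (smul_nonneg hs' ha) (smul_nonneg ht' hb)
  · rw [map_add, map_smul, map_smul, ha1, hb1, smul_eq_mul, smul_eq_mul, mul_one, mul_one]
    exact_mod_cast hst
  · rw [add_mul, map_add, smul_mul_assoc, smul_mul_assoc, map_smul, map_smul]
    simp

theorem densityRange_subset_absNumRange : densityRange τ c ⊆ absNumRange (c : H →L[ℂ] H) := by
  rintro - ⟨a, ha, ha1, rfl⟩
  have hle : StarAlgebra.elemental ℂ (c : H →L[ℂ] H) ≤ N.toStarSubalgebra :=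
    StarAlgebra.elemental.le_of_mem N.isClosed c.2
  refine ⟨τ.leftMul a ∘ₗ (StarSubalgebra.inclusion hle).toAlgHom.toLinearMap,
    ⟨?_, fun x => ?_⟩, rfl⟩
  · change τ.toFun (a * 1) = 1
    rw [mul_one, ha1]
  · change 0 ≤ τ.leftMul a (star (StarSubalgebra.inclusion hle x) * StarSubalgebra.inclusion hle x)
    exact τ.leftMul_star_mul_self_nonneg ha _

/-- A half-plane that contains the values of the density states contains the numerical range, by
self-duality of the positive cone. -/
theorem numRange_subset_closure_densityRange :
    numRange (c : H →L[ℂ] H) ⊆ closure (densityRange τ c) := by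
  rintro z ⟨x, hx, rfl⟩
  by_contra hz
  obtain ⟨l, u, hlu, hul⟩ := geometric_hahn_banach_closed_point (convex_densityRange τ c).closure
    isClosed_closure hz
  obtain ⟨w, hw⟩ := exists_re_mul_eq l
  set k : N.toStarSubalgebra := (u : ℂ) • 1 - (ℜ (w • c) : N.toStarSubalgebra) with hk
  have hksa : IsSelfAdjoint k := by
    have h1 : IsSelfAdjoint ((u : ℂ) • (1 : N.toStarSubalgebra)) :=
      IsSelfAdjoint.smul (Complex.conj_ofReal u) (.one _)
    exact h1.sub (ℜ (w • c)).2
  have hkcoe : (k : H →L[ℂ] H) = (u : ℂ) • 1 - (ℜ (w • (c : H →L[ℂ] H)) : H →L[ℂ] H) := by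
    change (u : ℂ) • (1 : H →L[ℂ] H) - ((ℜ (w • c) : N.toStarSubalgebra) : H →L[ℂ] H) = _
    rw [StarSubalgebra.coe_realPart]
    rfl
  have hpos : 0 ≤ (k : H →L[ℂ] H) := by
    refine τ.nonneg_of_forall_nonneg_map_mul hksa fun a ha => ?_
    have hre := map_realPart_eq_re (τ.leftMul_star_mul_self_nonneg ha) (w • c)
    rw [(τ.leftMul a).map_smul, τ.leftMul_apply, τ.leftMul_apply, smul_eq_mul] at hre
    have hak : τ.toFun (a * k) = u * τ.toFun a - ((w * τ.toFun (a * c)).re : ℂ) := by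
      rw [hk, mul_sub, mul_smul_comm, mul_one, τ.toFun.map_sub, τ.toFun.map_smul, hre, smul_eq_mul]
    have hta := Complex.nonneg_iff.1 (τ.map_nonneg ha)
    have hta' : τ.toFun a = ((τ.toFun a).re : ℂ) := Complex.ext rfl hta.2.symm
    rcases hta.1.eq_or_lt with h0 | h0
    · have : a = 0 := τ.eq_zero_of_nonneg_of_map_eq_zero ha (by rw [hta', ← h0]; rfl)
      simp [this]
    · set s : ℝ := (τ.toFun a).re
      have hs' : (0 : ℂ) ≤ ((s⁻¹ : ℝ) : ℂ) := by exact_mod_cast (inv_pos.2 h0).le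
      have hmem : τ.toFun (((s⁻¹ : ℝ) : ℂ) • a * c) ∈ densityRange τ c := by
        refine ⟨((s⁻¹ : ℝ) : ℂ) • a, ?_, ?_, rfl⟩
        · exact smul_nonneg hs' ha
        · rw [τ.toFun.map_smul, hta', smul_eq_mul, ← Complex.ofReal_mul, inv_mul_cancel₀ h0.ne',
            Complex.ofReal_one]
      have h1 := hlu _ (subset_closure hmem)
      rw [hw, smul_mul_assoc, τ.toFun.map_smul, smul_eq_mul, mul_left_comm, Complex.re_ofReal_mul,
        inv_mul_lt_iff₀ h0] at h1
      rw [hak, hta', ← Complex.ofReal_mul, ← Complex.ofReal_sub, Complex.ofReal_re]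
      linarith
  rw [hkcoe, smul_one_sub_realPart_nonneg_iff] at hpos
  have := hpos x hx
  rw [hw] at hul
  linarith

end Trace

/-! ### Slices of the spectral scale -/

section Slices
variable {H : Type*} [NormedAddCommGroup H] [InnerProductSpace ℂ H] [CompleteSpace H]
  {N : VonNeumannAlgebra H}

/-- The real space of self-adjoint elements of trace zero. -/
noncomputable def selfAdjointTraceZero (τ : FaithfulNormalTracialState N) :
    Submodule ℝ N.toStarSubalgebra where
  carrier := {d | IsSelfAdjoint d ∧ τ.toFun d = 0}
  add_mem' := fun ha hb => ⟨ha.1.add hb.1, by rw [map_add, ha.2, hb.2, add_zero]⟩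
  zero_mem' := ⟨.zero _, map_zero _⟩
  smul_mem' := fun r a ha => by
    have h : r • a = (r : ℂ) • a := Subtype.ext (Complex.coe_smul r (a : H →L[ℂ] H)).symm
    rw [h]
    exact ⟨IsSelfAdjoint.smul (Complex.conj_ofReal r) ha.1, by rw [map_smul, ha.2, smul_zero]⟩

/-- The direction (space of differences) in `ℂ` of the affine span of every slice `I_t`,
`0 < t < 1`, and of `W_ab(c)`: it is `ℂ`, a real line or `0`. -/
noncomputable def slopeSpace (τ : FaithfulNormalTracialState N) (c : N.toStarSubalgebra) :
    Submodule ℝ ℂ :=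
  (selfAdjointTraceZero τ).map ((τ.toFun ∘ₗ LinearMap.mulRight ℂ c).restrictScalars ℝ)

variable (τ : FaithfulNormalTracialState N) (c : N.toStarSubalgebra)

variable {τ c} in
theorem mem_slopeSpace {z : ℂ} :
    z ∈ slopeSpace τ c ↔ ∃ d, IsSelfAdjoint d ∧ τ.toFun d = 0 ∧ τ.toFun (d * c) = z := by
  constructor
  · rintro ⟨d, hd, rfl⟩
    exact ⟨d, hd.1, hd.2, rfl⟩
  · rintro ⟨d, hd, hd0, rfl⟩
    exact ⟨d, ⟨hd, hd0⟩, rfl⟩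

theorem map_mul_sub_mem_slopeSpace {d : N.toStarSubalgebra} (hd : IsSelfAdjoint d) :
    τ.toFun (d * c) - τ.toFun d * τ.toFun c ∈ slopeSpace τ c := by
  refine mem_slopeSpace.2 ⟨d - τ.toFun d • 1, ?_, ?_, ?_⟩
  · have h : IsSelfAdjoint (τ.toFun d • (1 : N.toStarSubalgebra)) := by
      rw [τ.map_eq_ofReal_re hd]
      exact IsSelfAdjoint.smul (Complex.conj_ofReal _) (.one _)
    exact hd.sub h
  · rw [map_sub, map_smul, τ.map_one, smul_eq_mul, mul_one, sub_self]
  · rw [sub_mul, map_sub, smul_mul_assoc, one_mul, map_smul, smul_eq_mul]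

/-- If the slope space is zero, then `c - τ(c)` is orthogonal to all of `N` for the inner product
of the trace, so it vanishes. -/
theorem nontrivial_slopeSpace (hc : c ≠ algebraMap ℂ N.toStarSubalgebra (τ.toFun c)) :
    Nontrivial (slopeSpace τ c) := by
  rw [Submodule.nontrivial_iff_ne_bot]
  intro hbot
  apply hc
  set c₀ : N.toStarSubalgebra := c - algebraMap ℂ N.toStarSubalgebra (τ.toFun c) with hc₀
  have h1 : ∀ d : N.toStarSubalgebra, IsSelfAdjoint d → τ.toFun (d * c₀) = 0 := by
    intro d hd
    have h2 := map_mul_sub_mem_slopeSpace τ c hd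
    rw [hbot, Submodule.mem_bot] at h2
    rw [hc₀, mul_sub, ← Algebra.commutes, ← Algebra.smul_def, map_sub, map_smul, smul_eq_mul,
      mul_comm (τ.toFun c)]
    exact h2
  have h3 : τ.toFun (star c₀ * c₀) = 0 := by
    rw [← realPart_add_I_smul_imaginaryPart (star c₀), add_mul, smul_mul_assoc, map_add, map_smul,
      h1 _ (ℜ (star c₀)).2, h1 _ (ℑ (star c₀)).2, smul_zero, add_zero]
  exact sub_eq_zero.1 (τ.faithful _ h3)

theorem convex_spectralScale : Convex ℝ (spectralScale τ c) := by
  rintro - ⟨a, ha, ha1, rfl⟩ - ⟨b, hb, hb1, rfl⟩ s t hs ht hst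
  have hs' : (0 : ℂ) ≤ s := by exact_mod_cast hs
  have ht' : (0 : ℂ) ≤ t := by exact_mod_cast ht
  refine ⟨(s : ℂ) • a + (t : ℂ) • b, ?_, ?_, ?_⟩
  · exact add_nonneg (smul_nonneg hs' ha) (smul_nonneg ht' hb)
  · change (s : ℂ) • (a : H →L[ℂ] H) + (t : ℂ) • (b : H →L[ℂ] H) ≤ 1
    calc (s : ℂ) • (a : H →L[ℂ] H) + (t : ℂ) • (b : H →L[ℂ] H)
        ≤ (s : ℂ) • (1 : H →L[ℂ] H) + (t : ℂ) • (1 : H →L[ℂ] H) :=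
          add_le_add (smul_le_smul_of_nonneg_left ha1 hs') (smul_le_smul_of_nonneg_left hb1 ht')
      _ = 1 := by
          rw [← add_smul, ← Complex.ofReal_add, hst, Complex.ofReal_one, one_smul]
  · rw [add_mul, map_add, map_add, smul_mul_assoc, smul_mul_assoc, map_smul, map_smul, map_smul,
      map_smul]
    simp

/-- The slice `I_t`, seen from the point of the central axis `(t, tτ(c))` and scaled by `1/t`. -/
def scaledSlice (t : ℝ) : Set (slopeSpace τ c) :=
  {v | ((t, t * v + t * τ.toFun c) : ℝ × ℂ) ∈ spectralScale τ c}

/-- `W_ab(c)`, seen from `τ(c)`. -/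
def centeredAbsNumRange : Set (slopeSpace τ c) :=
  {v | v + τ.toFun c ∈ absNumRange (c : H →L[ℂ] H)}

theorem convex_scaledSlice (t : ℝ) : Convex ℝ (scaledSlice τ c t) := by
  intro v hv w hw p q hp hq hpq
  have hpq' : (p : ℂ) + q = 1 := by exact_mod_cast hpq
  have h := convex_spectralScale τ c hv hw hp hq hpq
  rw [scaledSlice, Set.mem_ofPred_eq]
  convert h using 1
  refine Prod.ext ?_ ?_
  · simp [← add_mul, hpq]
  · simp
    linear_combination (-(t : ℂ) * τ.toFun c) * hpq'

/-- Scaling `a` by `s / t` maps the slice at `t` into the slice at `s`, so the scaled slices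
grow as `t` decreases. -/
theorem antitoneOn_scaledSlice : AntitoneOn (scaledSlice τ c) (Set.Ioo (0 : ℝ) 1) := by
  rintro s hs t ht hst v ⟨a, ha, ha1, hav⟩
  obtain ⟨h1, h2⟩ := Prod.ext_iff.1 hav
  simp only at h1 h2
  have ht0 : (t : ℂ) ≠ 0 := by exact_mod_cast ht.1.ne'
  have h0 : 0 ≤ s / t := div_nonneg hs.1.le ht.1.le
  have h0' : (0 : ℂ) ≤ ((s / t : ℝ) : ℂ) := by exact_mod_cast h0
  refine ⟨((s / t : ℝ) : ℂ) • a, smul_nonneg h0' ha, ?_, ?_⟩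
  · have h5 : ((s / t : ℝ) : ℂ) ≤ 1 := by exact_mod_cast (div_le_one ht.1).2 hst
    calc ((s / t : ℝ) : ℂ) • (a : H →L[ℂ] H) ≤ ((s / t : ℝ) : ℂ) • (1 : H →L[ℂ] H) :=
          smul_le_smul_of_nonneg_left ha1 h0'
      _ ≤ (1 : ℂ) • (1 : H →L[ℂ] H) :=
          smul_le_smul_of_nonneg_right h5 (ha.trans ha1)
      _ = 1 := one_smul _ _
  · rw [smul_mul_assoc, map_smul, map_smul, smul_eq_mul, smul_eq_mul, Complex.re_ofReal_mul,
      ← h1, ← h2]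
    refine Prod.ext ?_ ?_
    · have := ht.1.ne'
      simp only
      field_simp
    · push_cast
      field_simp

theorem map_mul_div_mem_densityRange {a : N.toStarSubalgebra} (ha : 0 ≤ (a : H →L[ℂ] H)) {t : ℝ}
    (ht : 0 < t) (hat : (τ.toFun a).re = t) : τ.toFun (a * c) / t ∈ densityRange τ c := by
  have h0 : (0 : ℂ) ≤ ((t⁻¹ : ℝ) : ℂ) := by exact_mod_cast (inv_pos.2 ht).le
  have ht0 : (t : ℂ) ≠ 0 := by exact_mod_cast ht.ne'
  have hta : τ.toFun a = t := Complex.ext hat (Complex.nonneg_iff.1 (τ.map_nonneg ha)).2.symm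
  refine ⟨((t⁻¹ : ℝ) : ℂ) • a, smul_nonneg h0 ha, ?_, ?_⟩
  · rw [map_smul, hta, smul_eq_mul, Complex.ofReal_inv, inv_mul_cancel₀ ht0]
  · rw [smul_mul_assoc, map_smul, smul_eq_mul, Complex.ofReal_inv]
    field_simp

theorem scaledSlice_subset {t : ℝ} (ht : t ∈ Set.Ioo (0 : ℝ) 1) :
    scaledSlice τ c t ⊆ centeredAbsNumRange τ c := by
  rintro v ⟨a, ha, ha1, hav⟩
  obtain ⟨h1, h2⟩ := Prod.ext_iff.1 hav
  simp only at h1 h2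
  have ht0 : (t : ℂ) ≠ 0 := by exact_mod_cast ht.1.ne'
  have h := densityRange_subset_absNumRange τ c (map_mul_div_mem_densityRange τ c ha ht.1 h1.symm)
  rw [← h2] at h
  rw [centeredAbsNumRange, Set.mem_ofPred_eq]
  convert h using 1
  field_simp

/-- For small self-adjoint `d` of trace zero, `t + d` lies between `0` and `1` and has trace `t`. A
linear right inverse of `d ↦ τ(dc)` on the finite-dimensional slope space is continuous, so all small
vectors of the slope space come from small `d`. -/
theorem scaledSlice_mem_nhds {t : ℝ} (ht : t ∈ Set.Ioo (0 : ℝ) 1) : scaledSlice τ c t ∈ 𝓝 0 := by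
  set L : N.toStarSubalgebra →ₗ[ℝ] ℂ := (τ.toFun ∘ₗ LinearMap.mulRight ℂ c).restrictScalars ℝ
  have : Module.Projective ℝ ((selfAdjointTraceZero τ).map L) :=
    @Module.Projective.of_free _ _ _ _ _ (Module.Free.of_divisionRing ℝ _)
  obtain ⟨R, hR⟩ := (L.submoduleMap (selfAdjointTraceZero τ)).exists_rightInverse_of_surjective
    (LinearMap.range_eq_top.2 (L.submoduleMap_surjective (selfAdjointTraceZero τ)))
  let coeL : N.toStarSubalgebra →ₗ[ℝ] (H →L[ℂ] H) :=
    (N.toStarSubalgebra.subtype.toAlgHom.toLinearMap).restrictScalars ℝ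
  let R' : slopeSpace τ c →ₗ[ℝ] (H →L[ℂ] H) := coeL ∘ₗ (selfAdjointTraceZero τ).subtype ∘ₗ R
  have hcont : Continuous fun v => R' ((t : ℝ) • v) :=
    R'.continuous_of_finiteDimensional.comp (continuous_const_smul t)
  have hmin : 0 < min t (1 - t) := lt_min ht.1 (sub_pos.2 ht.2)
  have hball : (fun v => R' ((t : ℝ) • v)) ⁻¹' Metric.closedBall 0 (min t (1 - t)) ∈ 𝓝 0 := by
    apply hcont.continuousAt
    simp only [smul_zero, map_zero]
    exact Metric.closedBall_mem_nhds _ hmin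
  filter_upwards [hball] with v hv
  rw [Set.mem_preimage, mem_closedBall_zero_iff] at hv
  set d : N.toStarSubalgebra := (R (t • v) : N.toStarSubalgebra) with hd
  have hdsa : IsSelfAdjoint d := (R (t • v)).2.1
  have hd0 : τ.toFun d = 0 := (R (t • v)).2.2
  have hdc : τ.toFun (d * c) = t * v := by
    have := congrArg Subtype.val (LinearMap.congr_fun hR (t • v))
    rw [show ((t : ℂ) * (v : ℂ)) = t • (v : ℂ) from Complex.real_smul.symm]
    exact this
  have hdn : ‖(d : H →L[ℂ] H)‖ ≤ min t (1 - t) := hv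
  have hdsa' : IsSelfAdjoint (d : H →L[ℂ] H) := congrArg Subtype.val hdsa
  have hup : (d : H →L[ℂ] H) ≤ algebraMap ℝ _ (1 - t) :=
    hdsa'.le_algebraMap_norm_self.trans
      (algebraMap_mono _ (hdn.trans (min_le_right _ _)))
  have hlow : -(algebraMap ℝ (H →L[ℂ] H) t) ≤ (d : H →L[ℂ] H) :=
    (neg_le_neg (algebraMap_mono _ (hdn.trans (min_le_left _ _)))).trans
      hdsa'.neg_algebraMap_norm_le_self
  have hcoe : (((t : ℂ) • (1 : N.toStarSubalgebra) + d : N.toStarSubalgebra) : H →L[ℂ] H) =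
      algebraMap ℝ (H →L[ℂ] H) t + d := by
    rw [Algebra.algebraMap_eq_smul_one, ← Complex.coe_smul]
    rfl
  refine ⟨(t : ℂ) • 1 + d, ?_, ?_, ?_⟩
  · rw [hcoe, add_comm]
    exact neg_le_iff_add_nonneg.1 hlow
  · rw [hcoe]
    refine (add_le_add_right hup _).trans_eq ?_
    rw [← map_add, add_sub_cancel, map_one]
  · rw [map_add, map_smul, τ.map_one, hd0, add_mul, smul_mul_assoc, one_mul, map_add, map_smul, hdc]
    simp [add_comm]

/-- Every density is a multiple of an element of the unit interval of `N`, so it occurs in the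
slices at small height. -/
theorem densityRange_subset_image_iUnion :
    densityRange τ c ⊆ (fun v : slopeSpace τ c => (v : ℂ) + τ.toFun c) ''
      ⋃ t : Set.Ioo (0 : ℝ) 1, scaledSlice τ c t := by
  rintro - ⟨a, ha, ha1, rfl⟩
  have hasa' : IsSelfAdjoint (a : H →L[ℂ] H) := .of_nonneg ha
  have hasa : IsSelfAdjoint a := Subtype.ext hasa'.star_eq
  have hv := map_mul_sub_mem_slopeSpace τ c hasa
  rw [ha1, one_mul] at hv
  refine ⟨⟨_, hv⟩, Set.mem_iUnion.2 ?_, sub_add_cancel _ _⟩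
  set t : ℝ := (‖(a : H →L[ℂ] H)‖ + 2)⁻¹ with ht
  have hpos : 0 < ‖(a : H →L[ℂ] H)‖ + 2 := by positivity
  have ht0 : 0 < t := inv_pos.2 hpos
  have ht1 : t < 1 := inv_lt_one_of_one_lt₀ (by linarith [norm_nonneg (a : H →L[ℂ] H)])
  have ht0' : (0 : ℂ) ≤ t := by exact_mod_cast ht0.le
  refine ⟨⟨t, ht0, ht1⟩, (t : ℂ) • a, smul_nonneg ht0' ha, ?_, ?_⟩
  · calc (t : ℂ) • (a : H →L[ℂ] H)
        ≤ (t : ℂ) • algebraMap ℝ (H →L[ℂ] H) ‖(a : H →L[ℂ] H)‖ :=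
          smul_le_smul_of_nonneg_left hasa'.le_algebraMap_norm_self ht0'
      _ = algebraMap ℝ (H →L[ℂ] H) (t * ‖(a : H →L[ℂ] H)‖) := by
          rw [map_mul, ← Algebra.smul_def, Complex.coe_smul]
      _ ≤ algebraMap ℝ (H →L[ℂ] H) 1 := by
          apply algebraMap_mono
          rw [ht, inv_mul_le_iff₀ hpos]
          linarith
      _ = 1 := map_one _
  · rw [map_smul, ha1, smul_mul_assoc, map_smul]
    refine Prod.ext ?_ ?_
    · simp
    · simp
      ring

theorem absNumRange_subset_closure_densityRange :
    absNumRange (c : H →L[ℂ] H) ⊆ closure (densityRange τ c) := by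
  rw [absNumRange_eq_closure_numRange]
  exact closure_minimal (numRange_subset_closure_densityRange τ c) isClosed_closure

theorem centeredAbsNumRange_subset :
    centeredAbsNumRange τ c ⊆ closure (⋃ t : Set.Ioo (0 : ℝ) 1, scaledSlice τ c t) := by
  intro v hv
  have hind : IsInducing fun v : slopeSpace τ c => (v : ℂ) + τ.toFun c :=
    (Homeomorph.addRight (τ.toFun c)).isInducing.comp .subtypeVal
  rw [hind.closure_eq_preimage_closure_image]
  exact closure_mono (densityRange_subset_image_iUnion τ c)
    (absNumRange_subset_closure_densityRange τ c hv)

theorem sub_mem_slopeSpace_of_mem_absNumRange {z : ℂ} (hz : z ∈ absNumRange (c : H →L[ℂ] H)) :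
    z - τ.toFun c ∈ slopeSpace τ c := by
  have hclosed : IsClosed {z : ℂ | z - τ.toFun c ∈ slopeSpace τ c} :=
    (slopeSpace τ c).closed_of_finiteDimensional.preimage (continuous_id.sub continuous_const)
  refine closure_minimal (fun z hz => ?_) hclosed (absNumRange_subset_closure_densityRange τ c hz)
  obtain ⟨v, -, rfl⟩ := densityRange_subset_image_iUnion τ c hz
  simp

theorem convex_centeredAbsNumRange : Convex ℝ (centeredAbsNumRange τ c) := by
  have h : Convex ℝ (absNumRange (c : H →L[ℂ] H)) := by
    rw [absNumRange_eq_closure_numRange]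
    exact (convex_numRange _).closure
  intro v hv w hw p q hp hq hpq
  have hpq' : (p : ℂ) + q = 1 := by exact_mod_cast hpq
  have h1 := h hv hw hp hq hpq
  rw [centeredAbsNumRange, Set.mem_ofPred_eq]
  convert h1 using 1
  simp
  linear_combination (-τ.toFun c) * hpq'

theorem isBounded_centeredAbsNumRange : Bornology.IsBounded (centeredAbsNumRange τ c) := by
  have h : Bornology.IsBounded (absNumRange (c : H →L[ℂ] H)) := by
    rw [absNumRange_eq_closure_numRange]
    exact (isBounded_numRange _).closure
  have hiso : Isometry fun v : slopeSpace τ c => (v : ℂ) + τ.toFun c :=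
    (IsometryEquiv.addRight (τ.toFun c)).isometry.comp isometry_subtype_coe
  exact hiso.antilipschitz.isBounded_preimage h

end Slices

/-! ### Radial slopes and relative boundaries -/

section RadialSlopes
variable {H : Type*} [NormedAddCommGroup H] [InnerProductSpace ℂ H] [CompleteSpace H]
  {N : VonNeumannAlgebra H} (τ : FaithfulNormalTracialState N) (c : N.toStarSubalgebra)

theorem isotraceSlice_eq_image {t : ℝ} (ht : t ∈ Set.Ioo (0 : ℝ) 1) :
    isotraceSlice τ c t = (fun v : slopeSpace τ c => ((t, v + t * τ.toFun c) : ℝ × ℂ)) ''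
      (t • scaledSlice τ c t) := by
  have ht0 : (t : ℂ) ≠ 0 := by exact_mod_cast ht.1.ne'
  ext p
  constructor
  · rintro ⟨⟨a, ha, ha1, rfl⟩, hpt⟩
    simp only at hpt
    have hasa : IsSelfAdjoint a := Subtype.ext (IsSelfAdjoint.of_nonneg ha).star_eq
    have hta : τ.toFun a = t := by rw [τ.map_eq_ofReal_re hasa, hpt]
    have hv := map_mul_sub_mem_slopeSpace τ c hasa
    rw [hta] at hv
    refine ⟨⟨_, hv⟩, ?_, ?_⟩
    · rw [Set.mem_smul_set_iff_inv_smul_mem₀ ht.1.ne']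
      refine ⟨a, ha, ha1, ?_⟩
      rw [hpt]
      refine Prod.ext rfl ?_
      simp
      field_simp
      ring
    · rw [hpt]
      exact Prod.ext rfl (sub_add_cancel _ _)
  · rintro ⟨-, ⟨v, hv, rfl⟩, rfl⟩
    refine ⟨?_, rfl⟩
    rw [scaledSlice, Set.mem_ofPred_eq] at hv
    convert hv using 2
    simp

/-- The embedding of the slope space as the affine span of the slice `I_t`. It preserves distances
because the first coordinate is constant. -/
noncomputable def sliceEmbedding (t : ℝ) : slopeSpace τ c →ᵃⁱ[ℝ] ℝ × ℂ :=
  { toFun := fun v => (t, v + t * τ.toFun c)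
    linear := LinearMap.inr ℝ ℝ ℂ ∘ₗ (slopeSpace τ c).subtype
    map_vadd' := fun p v => by simp [add_assoc]
    norm_map := fun v => by simp }

/-- The embedding of the slope space as the affine span of `W_ab(c)`. -/
noncomputable def absNumRangeEmbedding : slopeSpace τ c →ᵃⁱ[ℝ] ℂ :=
  { toFun := fun v => v + τ.toFun c
    linear := (slopeSpace τ c).subtype
    map_vadd' := fun p v => by simp [add_assoc]
    norm_map := fun v => by simp }

theorem absNumRange_eq_image :
    absNumRange (c : H →L[ℂ] H) = absNumRangeEmbedding τ c '' centeredAbsNumRange τ c := by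
  ext z
  constructor
  · intro hz
    refine ⟨⟨_, sub_mem_slopeSpace_of_mem_absNumRange τ c hz⟩, ?_, sub_add_cancel _ _⟩
    rw [centeredAbsNumRange, Set.mem_ofPred_eq]
    simpa using hz
  · rintro ⟨v, hv, rfl⟩
    exact hv

theorem centeredAbsNumRange_mem_nhds : centeredAbsNumRange τ c ∈ 𝓝 0 := by
  have hhalf : (1 / 2 : ℝ) ∈ Set.Ioo (0 : ℝ) 1 := by norm_num
  exact Filter.mem_of_superset (scaledSlice_mem_nhds τ c hhalf) (scaledSlice_subset τ c hhalf)

theorem gauge_centeredAbsNumRange_pos {u : slopeSpace τ c} (hu : u ≠ 0) :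
    0 < gauge (centeredAbsNumRange τ c) u :=
  (gauge_pos (absorbent_nhds_zero (centeredAbsNumRange_mem_nhds τ c))
    (NormedSpace.isVonNBounded_of_isBounded ℝ (isBounded_centeredAbsNumRange τ c))).2 hu

theorem gauge_scaledSlice_pos {t : ℝ} (ht : t ∈ Set.Ioo (0 : ℝ) 1) {u : slopeSpace τ c}
    (hu : u ≠ 0) : 0 < gauge (scaledSlice τ c t) u :=
  (gauge_centeredAbsNumRange_pos τ c hu).trans_le
    (gauge_mono (absorbent_nhds_zero (scaledSlice_mem_nhds τ c ht)) (scaledSlice_subset τ c ht) u)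

theorem tendsto_gauge_scaledSlice (u : slopeSpace τ c) :
    Tendsto (fun t => gauge (scaledSlice τ c t) u) (𝓝[>] 0)
      (𝓝 (gauge (centeredAbsNumRange τ c) u)) :=
  tendsto_gauge_of_antitoneOn (fun t _ => convex_scaledSlice τ c t)
    (fun _ ht => scaledSlice_mem_nhds τ c ht) (antitoneOn_scaledSlice τ c)
    (fun _ ht => scaledSlice_subset τ c ht) (convex_centeredAbsNumRange τ c)
    (centeredAbsNumRange_subset τ c) u

section Nonscalar
variable {τ c}

theorem relBoundary_absNumRange
    (hc : c ≠ algebraMap ℂ N.toStarSubalgebra (τ.toFun c)) :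
    relBoundary (absNumRange (c : H →L[ℂ] H)) =
      {z | ∃ v : slopeSpace τ c, gauge (centeredAbsNumRange τ c) v = 1 ∧ z = v + τ.toFun c} := by
  have := nontrivial_slopeSpace τ c hc
  rw [absNumRange_eq_image τ c, relBoundary_image_of_mem_nhds _ (centeredAbsNumRange_mem_nhds τ c)]
  ext z
  constructor
  · rintro ⟨v, hv, rfl⟩
    exact ⟨v, (gauge_eq_one_iff_mem_frontier (convex_centeredAbsNumRange τ c)
      (centeredAbsNumRange_mem_nhds τ c)).2 hv, rfl⟩
  · rintro ⟨v, hv, rfl⟩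
    exact ⟨v, (gauge_eq_one_iff_mem_frontier (convex_centeredAbsNumRange τ c)
      (centeredAbsNumRange_mem_nhds τ c)).1 hv, rfl⟩

theorem isSliceRadius_iff
    (hc : c ≠ algebraMap ℂ N.toStarSubalgebra (τ.toFun c)) {t : ℝ} (ht : t ∈ Set.Ioo (0 : ℝ) 1)
    (θ r : ℝ) :
    IsSliceRadius τ c t θ r ↔ 0 ≤ r ∧ ∃ v : slopeSpace τ c,
      (v : ℂ) = r * Complex.exp (θ * Complex.I) ∧ gauge (scaledSlice τ c t) v = t := by
  have := nontrivial_slopeSpace τ c hc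
  have hn : t • scaledSlice τ c t ∈ 𝓝 0 :=
    (set_smul_mem_nhds_zero_iff ht.1.ne').2 (scaledSlice_mem_nhds τ c ht)
  have hb : relBoundary (isotraceSlice τ c t) =
      sliceEmbedding τ c t '' frontier (t • scaledSlice τ c t) := by
    rw [isotraceSlice_eq_image τ c ht]
    exact relBoundary_image_of_mem_nhds (sliceEmbedding τ c t) hn
  have hg : ∀ v, v ∈ frontier (t • scaledSlice τ c t) ↔ gauge (scaledSlice τ c t) v = t := by
    intro v
    rw [← gauge_eq_one_iff_mem_frontier ((convex_scaledSlice τ c t).smul t) hn,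
      gauge_smul_left_of_nonneg ht.1.le, Pi.smul_apply, smul_eq_mul, inv_mul_eq_one₀ ht.1.ne',
      eq_comm]
  rw [IsSliceRadius, hb]
  refine and_congr_right fun _ => exists_congr fun v => ?_
  rw [hg, and_comm]
  refine and_congr_left fun _ => ?_
  constructor
  · intro h
    exact add_right_cancel (Prod.ext_iff.1 h).2
  · intro h
    exact Prod.ext rfl (congrArg (· + (t : ℂ) * τ.toFun c) h)

/-- A direction has radii exactly if it lies in the slope space, and these are the inverse gauges of
the slices. -/
theorem isRadialFunction_iff
    (hc : c ≠ algebraMap ℂ N.toStarSubalgebra (τ.toFun c)) (θ : ℝ) (r : ℝ → ℝ) :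
    IsRadialFunction τ c θ r ↔ ∃ u : slopeSpace τ c, (u : ℂ) = Complex.exp (θ * Complex.I) ∧
      ∀ t ∈ Set.Ioo (0 : ℝ) 1, r t / t = (gauge (scaledSlice τ c t) u)⁻¹ := by
  have hu0 : ∀ u : slopeSpace τ c, (u : ℂ) = Complex.exp (θ * Complex.I) → u ≠ 0 := by
    rintro u hu rfl
    exact Complex.exp_ne_zero _ hu.symm
  constructor
  · intro h
    obtain ⟨u, hu⟩ : ∃ u : slopeSpace τ c, (u : ℂ) = Complex.exp (θ * Complex.I) := by
      have hhalf : (1 / 2 : ℝ) ∈ Set.Ioo (0 : ℝ) 1 := by norm_num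
      obtain ⟨-, v, hv, hgv⟩ := (isSliceRadius_iff hc hhalf θ _).1 (h _ hhalf)
      have hr : r (1 / 2) ≠ 0 := by
        intro hr
        rw [hr, Complex.ofReal_zero, zero_mul] at hv
        rw [show v = 0 from Subtype.ext hv, gauge_zero] at hgv
        norm_num at hgv
      refine ⟨(r (1 / 2))⁻¹ • v, ?_⟩
      have hr' : (r (1 / 2) : ℂ) ≠ 0 := by exact_mod_cast hr
      rw [Submodule.coe_smul, hv, Complex.real_smul, Complex.ofReal_inv, inv_mul_cancel_left₀ hr']
    refine ⟨u, hu, fun t ht => ?_⟩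
    obtain ⟨hr, v, hv, hgv⟩ := (isSliceRadius_iff hc ht θ _).1 (h t ht)
    have hvu : v = r t • u := Subtype.ext (by rw [hv, Submodule.coe_smul, hu, Complex.real_smul])
    rw [hvu, gauge_smul_of_nonneg hr, smul_eq_mul] at hgv
    rw [div_eq_iff ht.1.ne', eq_inv_mul_iff_mul_eq₀ (gauge_scaledSlice_pos τ c ht (hu0 u hu)).ne',
      mul_comm]
    exact hgv
  · rintro ⟨u, hu, h⟩ t ht
    have hpos := gauge_scaledSlice_pos τ c ht (hu0 u hu)
    have hrt : r t = (gauge (scaledSlice τ c t) u)⁻¹ * t := (div_eq_iff ht.1.ne').1 (h t ht)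
    have hr : 0 ≤ r t := hrt ▸ mul_nonneg (inv_nonneg.2 hpos.le) ht.1.le
    refine (isSliceRadius_iff hc ht θ _).2 ⟨hr, r t • u, ?_, ?_⟩
    · rw [Submodule.coe_smul, hu, Complex.real_smul]
    · rw [gauge_smul_of_nonneg hr, hrt, smul_eq_mul]
      have := hpos.ne'
      field_simp

theorem tendsto_div_of_forall_eq_gauge_inv {r : ℝ → ℝ} {u : slopeSpace τ c} (hu : u ≠ 0)
    (h : ∀ t ∈ Set.Ioo (0 : ℝ) 1, r t / t = (gauge (scaledSlice τ c t) u)⁻¹) :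
    Tendsto (fun t => r t / t) (𝓝[>] 0) (𝓝 (gauge (centeredAbsNumRange τ c) u)⁻¹) := by
  refine ((tendsto_gauge_scaledSlice τ c u).inv₀
    (gauge_centeredAbsNumRange_pos τ c hu).ne').congr' ?_
  filter_upwards [Ioo_mem_nhdsGT one_pos] with t ht
  exact (h t ht).symm

theorem exists_tendsto_of_isRadialFunction
    (hc : c ≠ algebraMap ℂ N.toStarSubalgebra (τ.toFun c)) {θ : ℝ} {r : ℝ → ℝ}
    (h : IsRadialFunction τ c θ r) :
    ∃ u : slopeSpace τ c, (u : ℂ) = Complex.exp (θ * Complex.I) ∧ u ≠ 0 ∧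
      Tendsto (fun t => r t / t) (𝓝[>] 0) (𝓝 (gauge (centeredAbsNumRange τ c) u)⁻¹) := by
  obtain ⟨u, hu, hr⟩ := (isRadialFunction_iff hc θ r).1 h
  have hu0 : u ≠ 0 := by
    rintro rfl
    exact Complex.exp_ne_zero _ hu.symm
  exact ⟨u, hu, hu0, tendsto_div_of_forall_eq_gauge_inv hu0 hr⟩

theorem relBoundary_absNumRange_eq_radialComplexSlopes
    (hc : c ≠ algebraMap ℂ N.toStarSubalgebra (τ.toFun c)) :
    relBoundary (absNumRange (c : H →L[ℂ] H)) =
      {μ : ℂ | ∃ θ : ℝ, IsRadialComplexSlope τ c θ μ} := by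
  rw [relBoundary_absNumRange hc]
  ext μ
  constructor
  · rintro ⟨v, hv, rfl⟩
    have hv0 : v ≠ 0 := by
      rintro rfl
      rw [gauge_zero] at hv
      exact zero_ne_one hv
    have hn : 0 < ‖v‖ := norm_pos_iff.2 hv0
    have hn' : ((‖v‖ : ℝ) : ℂ) ≠ 0 := by exact_mod_cast hn.ne'
    have hpolar : (‖v‖ : ℂ) * Complex.exp ((v : ℂ).arg * Complex.I) = v :=
      Complex.norm_mul_exp_arg_mul_I (v : ℂ)
    set u : slopeSpace τ c := ‖v‖⁻¹ • v with hu
    have hue : (u : ℂ) = Complex.exp ((v : ℂ).arg * Complex.I) := by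
      rw [hu, Submodule.coe_smul, Complex.real_smul, Complex.ofReal_inv, inv_mul_eq_iff_eq_mul₀ hn']
      exact hpolar.symm
    have hu0 : u ≠ 0 := smul_ne_zero (inv_ne_zero hn.ne') hv0
    have hgu : (gauge (centeredAbsNumRange τ c) u)⁻¹ = ‖v‖ := by
      rw [hu, gauge_smul_of_nonneg (inv_nonneg.2 hn.le), hv, smul_eq_mul, mul_one, inv_inv]
    have hr : ∀ t ∈ Set.Ioo (0 : ℝ) 1,
        (gauge (scaledSlice τ c t) u)⁻¹ * t / t = (gauge (scaledSlice τ c t) u)⁻¹ :=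
      fun t ht => mul_div_cancel_right₀ _ ht.1.ne'
    refine ⟨(v : ℂ).arg, Or.inr ⟨hc, fun t => (gauge (scaledSlice τ c t) u)⁻¹ * t, ‖v‖,
      (isRadialFunction_iff hc _ _).2 ⟨u, hue, hr⟩, ?_, ?_⟩⟩
    · rw [← hgu]
      exact tendsto_div_of_forall_eq_gauge_inv hu0 hr
    · rw [hpolar]
  · rintro ⟨θ, ⟨h, -⟩ | ⟨-, r, ρ, hr, hρ, rfl⟩⟩
    · exact absurd h hc
    obtain ⟨u, hu, hu0, hlim⟩ := exists_tendsto_of_isRadialFunction hc hr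
    obtain rfl := tendsto_nhds_unique hρ hlim
    have hpos := gauge_centeredAbsNumRange_pos τ c hu0
    refine ⟨(gauge (centeredAbsNumRange τ c) u)⁻¹ • u, ?_, ?_⟩
    · rw [gauge_smul_of_nonneg (inv_nonneg.2 hpos.le), smul_eq_mul, inv_mul_cancel₀ hpos.ne']
    · rw [Submodule.coe_smul, hu, Complex.real_smul]

end Nonscalar

section Scalar
variable {τ c}

theorem map_mul_of_eq_algebraMap
    (hc : c = algebraMap ℂ N.toStarSubalgebra (τ.toFun c)) (a : N.toStarSubalgebra) :
    τ.toFun (a * c) = τ.toFun a * τ.toFun c := by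
  conv_lhs => rw [hc, ← Algebra.commutes, ← Algebra.smul_def, map_smul, smul_eq_mul, mul_comm]

theorem absNumRange_eq_singleton
    (hc : c = algebraMap ℂ N.toStarSubalgebra (τ.toFun c)) :
    absNumRange (c : H →L[ℂ] H) = {τ.toFun c} := by
  have h : densityRange τ c = {τ.toFun c} := by
    refine Set.eq_singleton_iff_unique_mem.2 ⟨⟨1, zero_le_one, τ.map_one, by rw [one_mul]⟩, ?_⟩
    rintro - ⟨a, -, ha1, rfl⟩
    rw [map_mul_of_eq_algebraMap hc, ha1, one_mul]
  refine Set.Subset.antisymm ?_ (h ▸ densityRange_subset_absNumRange τ c)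
  have h1 := absNumRange_subset_closure_densityRange τ c
  rwa [h, closure_singleton] at h1

theorem isotraceSlice_eq_singleton
    (hc : c = algebraMap ℂ N.toStarSubalgebra (τ.toFun c)) {t : ℝ} (ht : t ∈ Set.Ioo (0 : ℝ) 1) :
    isotraceSlice τ c t = {(t, t * τ.toFun c)} := by
  have h : ∀ p ∈ isotraceSlice τ c t, p = (t, t * τ.toFun c) := by
    rintro - ⟨⟨a, ha, -, rfl⟩, hpt⟩
    have hasa : IsSelfAdjoint a := Subtype.ext (IsSelfAdjoint.of_nonneg ha).star_eq
    rw [map_mul_of_eq_algebraMap hc, τ.map_eq_ofReal_re hasa, ← hpt, Complex.ofReal_re]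
  refine Set.eq_singleton_iff_nonempty_unique_mem.2 ⟨?_, h⟩
  rw [isotraceSlice_eq_image τ c ht]
  exact (Set.Nonempty.smul_set ⟨0, mem_of_mem_nhds (scaledSlice_mem_nhds τ c ht)⟩).image _

theorem radius_eq_zero
    (hc : c = algebraMap ℂ N.toStarSubalgebra (τ.toFun c)) {t θ r : ℝ} (ht : t ∈ Set.Ioo (0 : ℝ) 1)
    (h : IsSliceRadius τ c t θ r) :
    r = 0 := by
  have h1 := h.2
  rw [isotraceSlice_eq_singleton hc ht, relBoundary_singleton, Set.mem_singleton_iff] at h1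
  simpa using (Prod.ext_iff.1 h1).2

end Scalar

end RadialSlopes

theorem theorem2p6 {H : Type*} [NormedAddCommGroup H] [InnerProductSpace ℂ H] [CompleteSpace H]
    (N : VonNeumannAlgebra H) (c : N.toStarSubalgebra)
    (hc : IsVonNeumannGeneratedBy N (c : H →L[ℂ] H)) (τ : FaithfulNormalTracialState N) :
    absNumRange (c : H →L[ℂ] H) = closure (numRange (c : H →L[ℂ] H)) ∧
    (∀ (θ : ℝ) (r : ℝ → ℝ), IsRadialFunction τ c θ r →
      ∃ ρ : ℝ, Tendsto (fun t => r t / t) (𝓝[>] 0) (𝓝 ρ)) ∧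
    relBoundary (absNumRange (c : H →L[ℂ] H)) =
      {μ : ℂ | ∃ θ : ℝ, IsRadialComplexSlope τ c θ μ} := by
  refine ⟨absNumRange_eq_closure_numRange _, ?_⟩
  by_cases hs : c = algebraMap ℂ N.toStarSubalgebra (τ.toFun c)
  · refine ⟨fun θ r hr => ⟨0, ?_⟩, ?_⟩
    · refine tendsto_const_nhds.congr' ?_
      filter_upwards [Ioo_mem_nhdsGT one_pos] with t ht
      rw [radius_eq_zero hs ht (hr t ht), zero_div]
    · rw [absNumRange_eq_singleton hs, relBoundary_singleton]
      ext μ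
      constructor
      · rintro rfl
        exact ⟨0, Or.inl ⟨hs, rfl, rfl⟩⟩
      · rintro ⟨θ, ⟨-, -, rfl⟩ | ⟨h, -⟩⟩
        · rfl
        · exact absurd hs h
  · exact ⟨fun θ r hr => let ⟨_, _, _, h⟩ := exists_tendsto_of_isRadialFunction hs hr
      ⟨_, h⟩, relBoundary_absNumRange_eq_radialComplexSlopes hs⟩
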